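/- Let $G$ be an arbitrary group and $\mathbb{Z}G$ its integral group ring. For a finite subgroup $H$ of $G$ write $\overline{H}=\sum_{g\in H} g\in\mathbb{Z}G$, and for $x\in G$ and $h\in H$ let $$\beta_{x,h,H}=1+(1-h)x\overline{H},\qquad \gamma_{x,h,H}=1+\overline{H}x(1-h),$$ which are units of $\mathbb{Z}G$ (each is of the form $1+a$ with $a^2=0$). A pair $(u,v)$ of units of $\mathbb{Z}G$ is called a free pair if $u$ and $v$ freely generate a (non-abelian) free group of rank two. Let $H\le K$ be finite subgroups of $G$ and let $x\in G$, $h\in H$ and $k\in K$ be such that $x^{-1}hx\notin K$. (1) If $x^{-1}kx\notin K$, then $(\beta_{x,h,H},\gamma_{x^{-1},k,K})$ is a free pair. (2) If $xkx^{-1}\notin K$, then $(\beta_{x,h,H},\beta_{x^{-1},\,xkx^{-1},\,xKx^{-1}})$ is a free pair. -/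

import Mathlib

/-- The pair `(u, v)` of elements of a group is a *free pair*: `u` and `v` freely generate a
(non-abelian) free group of rank two, i.e. no non-trivial reduced word in `u, v` is trivial. -/
def IsFreePair {Γ : Type*} [Group Γ] (u v : Γ) : Prop :=
  Function.Injective (FreeGroup.lift (![u, v] : Fin 2 → Γ))

/-- In any ring, `1 + a` is a unit with inverse `1 - a` when `a ^ 2 = 0`. -/
def unitOneAdd {R : Type*} [Ring R] (a : R) (ha : a * a = 0) : Rˣ where
  val := 1 + a
  inv := 1 - a
  val_inv := by rw [add_mul, mul_sub, mul_sub, ha]; simp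
  inv_val := by rw [sub_mul, mul_add, mul_add, ha]; simp

namespace IntegralGroupRing

variable {G : Type*} [Group G]

/-- The element `g` of `G`, seen in the integral group ring `ℤ G`. -/
noncomputable def el (g : G) : MonoidAlgebra ℤ G := MonoidAlgebra.of ℤ G g

/-- The sum in `ℤ G` of the elements of a finite subgroup `H`. -/
noncomputable def subgroupSum (H : Subgroup G) [Finite H] : MonoidAlgebra ℤ G :=
  ∑ g ∈ (Set.toFinite (H : Set G)).toFinset, el g

theorem subgroupSum_mul_el (H : Subgroup G) [Finite H] {h : G} (hh : h ∈ H) :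
    subgroupSum H * el h = subgroupSum H := by
  unfold subgroupSum
  rw [Finset.sum_mul]
  refine Finset.sum_bij' (fun g _ => g * h) (fun g _ => g * h⁻¹) ?_ ?_ ?_ ?_ ?_
  · intro g hg
    simp only [Set.Finite.mem_toFinset, SetLike.mem_coe] at hg ⊢
    exact H.mul_mem hg hh
  · intro g hg
    simp only [Set.Finite.mem_toFinset, SetLike.mem_coe] at hg ⊢
    exact H.mul_mem hg (H.inv_mem hh)
  · intro g _; simp
  · intro g _; simp
  · intro g _; simp [el]

theorem subgroupSum_mul_one_sub (H : Subgroup G) [Finite H] {h : G} (hh : h ∈ H) :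
    subgroupSum H * (1 - el h) = 0 := by
  rw [mul_sub, mul_one, subgroupSum_mul_el H hh, sub_self]

theorem beta_sq (x h : G) (H : Subgroup G) [Finite H] (hh : h ∈ H) :
    ((1 - el h) * el x * subgroupSum H) * ((1 - el h) * el x * subgroupSum H) = 0 := by
  calc _ = (1 - el h) * el x * (subgroupSum H * (1 - el h)) * (el x * subgroupSum H) := by
        simp only [mul_assoc]
    _ = 0 := by rw [subgroupSum_mul_one_sub H hh]; simp

theorem gamma_sq (x h : G) (H : Subgroup G) [Finite H] (hh : h ∈ H) :
    (subgroupSum H * el x * (1 - el h)) * (subgroupSum H * el x * (1 - el h)) = 0 := by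
  have key : (1 - el h) * subgroupSum H = 0 := by
    have : el h * subgroupSum H = subgroupSum H := by
      unfold subgroupSum
      rw [Finset.mul_sum]
      refine Finset.sum_bij' (fun g _ => h * g) (fun g _ => h⁻¹ * g) ?_ ?_ ?_ ?_ ?_
      · intro g hg
        simp only [Set.Finite.mem_toFinset, SetLike.mem_coe] at hg ⊢
        exact H.mul_mem hh hg
      · intro g hg
        simp only [Set.Finite.mem_toFinset, SetLike.mem_coe] at hg ⊢
        exact H.mul_mem (H.inv_mem hh) hg
      · intro g _; simp
      · intro g _; simp
      · intro g _; simp [el]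
    rw [sub_mul, one_mul, this, sub_self]
  calc _ = subgroupSum H * el x * ((1 - el h) * subgroupSum H) * (el x * (1 - el h)) := by
        simp only [mul_assoc]
    _ = 0 := by rw [key]; simp

/-- The unit `β_{x,h,H} = 1 + (1 - h) x H̄` of `ℤ G`, for `H` a finite subgroup and `h ∈ H`. -/
noncomputable def beta (x h : G) (H : Subgroup G) [Finite H] (hh : h ∈ H) :
    (MonoidAlgebra ℤ G)ˣ :=
  unitOneAdd ((1 - el h) * el x * subgroupSum H) (beta_sq x h H hh)

/-- The unit `γ_{x,h,H} = 1 + H̄ x (1 - h)` of `ℤ G`, for `H` a finite subgroup and `h ∈ H`. -/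
noncomputable def gamma (x h : G) (H : Subgroup G) [Finite H] (hh : h ∈ H) :
    (MonoidAlgebra ℤ G)ˣ :=
  unitOneAdd (subgroupSum H * el x * (1 - el h)) (gamma_sq x h H hh)

/-- The conjugate subgroup `x K x⁻¹`. -/
def conjSubgroup (x : G) (K : Subgroup G) : Subgroup G :=
  K.map (MulAut.conj x).toMonoidHom

theorem conj_mem_conjSubgroup (x : G) {K : Subgroup G} {k : G} (hk : k ∈ K) :
    x * k * x⁻¹ ∈ conjSubgroup x K :=
  ⟨k, hk, rfl⟩

instance finite_conjSubgroup (x : G) (K : Subgroup G) [Finite K] : Finite (conjSubgroup x K) :=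
  ((Set.toFinite (K : Set G)).image (MulAut.conj x)).to_subtype

end IntegralGroupRing

/-! Write the two units as `1 + a` and `1 + b`. Left multiplication by `a` and `b` on the right
`ℂ[ab]`-module spanned by `ab` and `b` is given by the matrices `!![0, 1; 0, 0]` and `!![0, 0; X,
0]`, with `X` standing for `ab`. If every polynomial killing `ab` vanishes at some `t` with `4 ≤
‖t‖`, a trivial word stays trivial after `X ↦ t`, where ping-pong on `ℂ²` shows freeness
(`isFreePair_unitOneAdd_of_root`).

Such a `t` comes from the trace on `ℓ²(G)`. Factor `ab = uv` so that `vu = w K̄`; nonzero spectral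
values of `uv` and `vu` agree. The operator `w K̄` kills `ker K̄`, whose complement has von Neumann
dimension `1/|K|`, and its trace is a sum of spectral values weighted by dimensions. Hence some
value has modulus at least `|K|` times the modulus of the trace
(`exists_root_of_le_norm_ltwoTrace`). Counting elements of `K` gives trace at least `|H| ≥ 2`, and
`|K| ≥ 2` as well, whence the bound `4` (`isFreePair_of_sum`). -/

/-! ### Ping-pong for free groups. -/

section PingPong

open scoped Pointwise Function

/-- The ping-pong lemma for free groups, with one set for each generator. -/
theorem FreeGroup.injective_lift_of_zpow_ping_pong {ι Γ α : Type*} [Nontrivial ι] [Group Γ]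
    [MulAction Γ α] (a : ι → Γ) (X : ι → Set α) (hne : ∀ i, (X i).Nonempty)
    (hdisj : Pairwise (Disjoint on X))
    (hpp : ∀ i j, i ≠ j → ∀ n : ℤ, n ≠ 0 → ∀ p ∈ X j, a i ^ n • p ∈ X i) :
    Function.Injective (FreeGroup.lift a) := by
  have hlift : FreeGroup.lift a =
      (Monoid.CoprodI.lift fun i => FreeGroup.lift fun _ => a i).comp
        (@freeGroupEquivCoprodI ι).toMonoidHom := by
    ext i
    simp
  rw [hlift, MonoidHom.coe_comp]
  refine Function.Injective.comp ?_ (MulEquiv.injective freeGroupEquivCoprodI)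
  refine Monoid.CoprodI.lift_injective_of_ping_pong
    (fun i : ι => FreeGroup.lift fun _ : Unit => a i) ?_ X hne hdisj ?_
  -- Ping-pong for free products needs three factors or a factor with at least three elements; here
  -- each factor is infinite cyclic.
  · inhabit ι
    refine Or.inr ⟨default, ?_⟩
    rw [FreeGroup.freeGroupUnitEquivInt.cardinal_eq, Cardinal.mk_denumerable]
    exact Cardinal.natCast_le_aleph0
  · intro i j hij
    refine FreeGroup.freeGroupUnitEquivInt.forall_congr_left.mpr ?_
    intro n hn
    change FreeGroup.lift (fun _ => a i) (FreeGroup.of () ^ n) • X j ⊆ X i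
    rw [map_zpow, FreeGroup.lift_apply_of]
    rintro _ ⟨p, hp, rfl⟩
    refine hpp i j hij n ?_ p hp
    rintro rfl
    exact hn (by simp [FreeGroup.freeGroupUnitEquivInt])

end PingPong

/-! ### Free pairs under homomorphisms, and powers of `1 + a`. -/

theorem IsFreePair.of_map {Γ Δ : Type*} [Group Γ] [Group Δ] (f : Γ →* Δ) {u v : Γ}
    (h : IsFreePair (f u) (f v)) : IsFreePair u v := by
  have hcomp : FreeGroup.lift (![f u, f v] : Fin 2 → Δ) =
      f.comp (FreeGroup.lift (![u, v] : Fin 2 → Γ)) := by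
    ext i
    fin_cases i <;> simp
  rw [IsFreePair, hcomp, MonoidHom.coe_comp] at h
  exact h.of_comp

theorem map_unitOneAdd {R S : Type*} [Ring R] [Ring S] (f : R →+* S) (a : R) (ha : a * a = 0)
    (b : S) (hb : b * b = 0) (hab : f a = b) :
    Units.map (f : R →* S) (unitOneAdd a ha) = unitOneAdd b hb := by
  ext
  simp [unitOneAdd, hab]

theorem IsFreePair.of_map_unitOneAdd {R S : Type*} [Ring R] [Ring S] (f : R →+* S) {a b : R}
    (ha : a * a = 0) (hb : b * b = 0) (ha' : f a * f a = 0) (hb' : f b * f b = 0)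
    (h : IsFreePair (unitOneAdd (f a) ha') (unitOneAdd (f b) hb')) :
    IsFreePair (unitOneAdd a ha) (unitOneAdd b hb) := by
  refine IsFreePair.of_map (Units.map (f : R →* S)) ?_
  rwa [map_unitOneAdd f a ha _ ha' rfl, map_unitOneAdd f b hb _ hb' rfl]

theorem val_unitOneAdd {R : Type*} [Ring R] (a : R) (ha : a * a = 0) :
    (unitOneAdd a ha : R) = 1 + a := rfl

theorem val_inv_unitOneAdd {R : Type*} [Ring R] (a : R) (ha : a * a = 0) :
    (((unitOneAdd a ha)⁻¹ : Rˣ) : R) = 1 - a := rfl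

theorem val_unitOneAdd_zpow {R : Type*} [Ring R] (a : R) (ha : a * a = 0) (n : ℤ) :
    ((unitOneAdd a ha ^ n : Rˣ) : R) = 1 + n • a := by
  induction n using Int.induction_on with
  | zero => simp
  | succ n ih =>
    have h : (n : ℤ) • a * a = 0 := by rw [smul_mul_assoc, ha, smul_zero]
    rw [zpow_add_one, Units.val_mul, ih, val_unitOneAdd, add_mul, mul_add, mul_add, h, add_smul]
    simp only [mul_one, one_mul, add_zero, one_smul]
    abel
  | pred n ih =>
    have h : (-n : ℤ) • a * a = 0 := by rw [smul_mul_assoc, ha, smul_zero]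
    rw [zpow_sub_one, Units.val_mul, ih, val_inv_unitOneAdd, add_mul, mul_sub, mul_sub, h, sub_smul]
    simp only [mul_one, one_mul, sub_zero, one_smul]
    abel

/-! ### Elementary matrices over `ℂ`. -/

section Matrix

variable {S : Type*} [CommRing S]

/-- The strictly upper triangular matrix unit of size two. -/
def upperNilpotent (S : Type*) [CommRing S] : Matrix (Fin 2) (Fin 2) S := !![0, 1; 0, 0]

/-- The strictly lower triangular matrix of size two with entry `t`. -/
def lowerNilpotent (t : S) : Matrix (Fin 2) (Fin 2) S := !![0, 0; t, 0]

theorem upperNilpotent_sq : upperNilpotent S * upperNilpotent S = 0 := by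
  ext i j; fin_cases i <;> fin_cases j <;> simp [upperNilpotent]

theorem lowerNilpotent_sq (t : S) : lowerNilpotent t * lowerNilpotent t = 0 := by
  ext i j; fin_cases i <;> fin_cases j <;> simp [lowerNilpotent]

/-- The elementary matrices with off-diagonal entries `1` and `t`. -/
def elementaryPair (t : S) : Fin 2 → (Matrix (Fin 2) (Fin 2) S)ˣ :=
  ![unitOneAdd (upperNilpotent S) upperNilpotent_sq,
    unitOneAdd (lowerNilpotent t) (lowerNilpotent_sq t)]

/-- Ping-pong between the two cones cut out by slope `2`: the upper powers need slope at least `2`,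
and then the lower powers need `‖t‖ - 2 ≥ 2`. -/
theorem isFreePair_elementary {t : ℂ} (ht : 4 ≤ ‖t‖) :
    IsFreePair (unitOneAdd (upperNilpotent ℂ) upperNilpotent_sq)
      (unitOneAdd (lowerNilpotent t) (lowerNilpotent_sq t)) := by
  let φ : Matrix (Fin 2) (Fin 2) ℂ →+* Module.End ℂ (Fin 2 → ℂ) :=
    (Matrix.toLinAlgEquiv' : Matrix (Fin 2) (Fin 2) ℂ ≃ₐ[ℂ] _).toRingEquiv.toRingHom
  have hφ (m : Matrix (Fin 2) (Fin 2) ℂ) (p : Fin 2 → ℂ) : φ m p = m.mulVec p := rfl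
  refine IsFreePair.of_map (Units.map (φ : _ →* Module.End ℂ (Fin 2 → ℂ))) ?_
  have hact (m : Matrix (Fin 2) (Fin 2) ℂ) (hm : m * m = 0) (n : ℤ) (p : Fin 2 → ℂ) :
      (Units.map (φ : _ →* Module.End ℂ (Fin 2 → ℂ)) (unitOneAdd m hm) ^ n) • p
        = p + n • m.mulVec p := by
    rw [← map_zpow, Units.smul_def, Units.coe_map, val_unitOneAdd_zpow]
    simp [map_add, hφ]
  refine FreeGroup.injective_lift_of_zpow_ping_pong _
    (![{p | ‖p 1‖ < 2 * ‖p 0‖}, {p | 2 * ‖p 0‖ < ‖p 1‖}] : Fin 2 → Set (Fin 2 → ℂ)) ?_ ?_ ?_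
  · intro i
    fin_cases i
    · exact ⟨![1, 0], by simp⟩
    · exact ⟨![0, 1], by simp⟩
  · have h01 : Disjoint {p : Fin 2 → ℂ | ‖p 1‖ < 2 * ‖p 0‖} {p | 2 * ‖p 0‖ < ‖p 1‖} :=
      Set.disjoint_left.mpr fun p hp hq => lt_asymm (Set.mem_ofPred.mp hp) hq
    intro i j hij
    fin_cases i <;> fin_cases j
    · exact absurd rfl hij
    · exact h01
    · exact h01.symm
    · exact absurd rfl hij
  · intro i j hij n hn p hp
    have hn1 : (1 : ℝ) ≤ ‖(n : ℂ)‖ := by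
      rw [Complex.norm_intCast]
      exact_mod_cast Int.one_le_abs hn
    fin_cases i <;> fin_cases j
    · exact absurd rfl hij
    · replace hp : 2 * ‖p 0‖ < ‖p 1‖ := hp
      simp only [Fin.zero_eta, Matrix.cons_val_zero, hact, Set.mem_ofPred_eq]
      have h0 : (p + n • (upperNilpotent ℂ).mulVec p) 0 = p 0 + n * p 1 := by
        simp [upperNilpotent, dotProduct]
      have h1 : (p + n • (upperNilpotent ℂ).mulVec p) 1 = p 1 := by
        simp [upperNilpotent, dotProduct]
      rw [h0, h1]
      have h2 : ‖(n : ℂ) * p 1‖ ≤ ‖p 0 + n * p 1‖ + ‖p 0‖ := by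
        simpa using norm_sub_le (p 0 + n * p 1) (p 0)
      rw [norm_mul] at h2
      nlinarith [norm_nonneg (p 1)]
    · replace hp : ‖p 1‖ < 2 * ‖p 0‖ := hp
      simp only [Fin.mk_one, Matrix.cons_val_one, Matrix.cons_val_fin_one, hact, Set.mem_ofPred_eq]
      have h0 : (p + n • (lowerNilpotent t).mulVec p) 0 = p 0 := by
        simp [lowerNilpotent, dotProduct]
      have h1 : (p + n • (lowerNilpotent t).mulVec p) 1 = p 1 + n * (t * p 0) := by
        simp [lowerNilpotent, dotProduct]
      rw [h0, h1]
      have h2 : ‖(n : ℂ) * (t * p 0)‖ ≤ ‖p 1 + n * (t * p 0)‖ + ‖p 1‖ := by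
        simpa using norm_sub_le (p 1 + n * (t * p 0)) (p 1)
      rw [norm_mul, norm_mul] at h2
      have h3 : 4 * ‖p 0‖ ≤ ‖t‖ * ‖p 0‖ := by gcongr
      nlinarith [mul_nonneg (norm_nonneg t) (norm_nonneg (p 0))]
    · exact absurd rfl hij

end Matrix

/-! ### From words in `1 + a`, `1 + b` to polynomial matrices. -/

section SquareZero

open Polynomial

variable {R : Type*} [Ring R] [Algebra ℂ R]

/-- Left multiplication by `r` on the right `ℂ[ab]`-module spanned by `ab` and `b` is given by the
polynomial matrix `m`. -/
structure ActsByMatrix (a b r : R) (m : Matrix (Fin 2) (Fin 2) ℂ[X]) : Prop where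
  mul_mul : r * (a * b) = a * b * aeval (a * b) (m 0 0) + b * aeval (a * b) (m 1 0)
  mul : r * b = a * b * aeval (a * b) (m 0 1) + b * aeval (a * b) (m 1 1)

namespace ActsByMatrix

variable {a b : R}

theorem one : ActsByMatrix a b 1 1 := ⟨by simp, by simp⟩

theorem comp {r s : R} {m n : Matrix (Fin 2) (Fin 2) ℂ[X]} (hr : ActsByMatrix a b r m)
    (hs : ActsByMatrix a b s n) : ActsByMatrix a b (r * s) (m * n) := by
  constructor
  · rw [mul_assoc, hs.mul_mul, mul_add, ← mul_assoc r (a * b), ← mul_assoc r b, hr.mul_mul, hr.mul]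
    simp only [Matrix.mul_apply, Fin.sum_univ_two, map_add, map_mul, mul_add, add_mul, mul_assoc]
    abel
  · rw [mul_assoc, hs.mul, mul_add, ← mul_assoc r (a * b), ← mul_assoc r b, hr.mul_mul, hr.mul]
    simp only [Matrix.mul_apply, Fin.sum_univ_two, map_add, map_mul, mul_add, add_mul, mul_assoc]
    abel

theorem lift (ha : a * a = 0) (hb : b * b = 0) (w : FreeGroup (Fin 2)) :
    ActsByMatrix a b (FreeGroup.lift ![unitOneAdd a ha, unitOneAdd b hb] w : Rˣ)
      (FreeGroup.lift (elementaryPair (X : ℂ[X])) w : (Matrix (Fin 2) (Fin 2) ℂ[X])ˣ) := by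
  have haab : a * (a * b) = 0 := by rw [← mul_assoc, ha, zero_mul]
  induction w using FreeGroup.induction_on with
  | C1 => simpa using one
  | of i =>
    fin_cases i <;> constructor <;>
      simp [elementaryPair, val_unitOneAdd, upperNilpotent, lowerNilpotent, add_mul, haab, hb,
        add_comm]
  | inv_of i _ =>
    fin_cases i <;> constructor <;>
      simp [elementaryPair, val_inv_unitOneAdd, upperNilpotent, lowerNilpotent, sub_mul, haab, hb,
        neg_add_eq_sub]
    exact sub_eq_add_neg _ _
  | mul v w hv hw =>
    simp only [map_mul, Units.val_mul]
    exact hv.comp hw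

/-- The generators `ab` and `b` may be dependent, so `m` need not be `1`. Left multiplication by `a`
kills the `ab` term and isolates the second row; by `ab` it kills the `b` term and isolates the
first. The factor `X ^ 2` covers both cases. -/
theorem aeval_eq_zero (ha : a * a = 0) (hb : b * b = 0) {m : Matrix (Fin 2) (Fin 2) ℂ[X]}
    (h : ActsByMatrix a b 1 m) (i j : Fin 2) : aeval (a * b) (X ^ 2 * (m - 1) i j) = 0 := by
  have haab (z : R) : a * (a * z) = 0 := by rw [← mul_assoc, ha, zero_mul]
  have hbb (z : R) : b * (b * z) = 0 := by rw [← mul_assoc, hb, zero_mul]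
  have h1 := h.mul_mul
  have h2 := h.mul
  have h3 := congrArg (a * ·) h1
  have h4 := congrArg (a * ·) h2
  have h5 := congrArg (a * b * ·) h1
  have h6 := congrArg (a * b * ·) h2
  simp only [one_mul, mul_add, mul_assoc, haab, hb, hbb, mul_zero, zero_add, add_zero]
    at h3 h4 h5 h6
  fin_cases i <;> fin_cases j <;>
    simp only [Fin.zero_eta, Fin.mk_one, Matrix.sub_apply, Matrix.one_apply, map_mul, map_sub,
      aeval_X, pow_two, mul_sub, mul_assoc] <;> simp
  · rw [← h5, sub_self]
  · exact h6.symm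
  · rw [← h3, mul_zero, mul_zero]
  · rw [← h4, sub_self]

end ActsByMatrix

theorem isFreePair_unitOneAdd_of_root {a b : R} (ha : a * a = 0) (hb : b * b = 0) {t : ℂ}
    (ht : 4 ≤ ‖t‖) (hroot : ∀ f : ℂ[X], aeval (a * b) f = 0 → f.eval t = 0) :
    IsFreePair (unitOneAdd a ha) (unitOneAdd b hb) := by
  refine (injective_iff_map_eq_one _).mpr fun w hw => ?_
  have hfree := isFreePair_elementary ht
  refine (injective_iff_map_eq_one _).mp hfree w ?_
  have hmat := ActsByMatrix.lift ha hb w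
  rw [hw, Units.val_one] at hmat
  let φ : Matrix (Fin 2) (Fin 2) ℂ[X] →+* Matrix (Fin 2) (Fin 2) ℂ := (evalRingHom t).mapMatrix
  have hcomp : FreeGroup.lift ![unitOneAdd (upperNilpotent ℂ) upperNilpotent_sq,
        unitOneAdd (lowerNilpotent t) (lowerNilpotent_sq t)] =
      (Units.map (φ : _ →* Matrix (Fin 2) (Fin 2) ℂ)).comp
        (FreeGroup.lift (elementaryPair (X : ℂ[X]))) := by
    ext i : 1
    fin_cases i
    · simp only [Fin.zero_eta, FreeGroup.lift_apply_of, MonoidHom.comp_apply, elementaryPair,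
        Matrix.cons_val_zero]
      refine (map_unitOneAdd φ _ _ _ _ ?_).symm
      ext i j; fin_cases i <;> fin_cases j <;> simp [φ, upperNilpotent]
    · simp only [Fin.mk_one, FreeGroup.lift_apply_of, MonoidHom.comp_apply, elementaryPair,
        Matrix.cons_val_one, Matrix.cons_val_fin_one]
      refine (map_unitOneAdd φ _ _ _ _ ?_).symm
      ext i j; fin_cases i <;> fin_cases j <;> simp [φ, lowerNilpotent]
  rw [hcomp, MonoidHom.comp_apply]
  ext i j
  have hij := hroot _ (hmat.aeval_eq_zero ha hb i j)
  have ht0 : t ^ 2 ≠ 0 := by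
    refine pow_ne_zero 2 fun h => ?_
    rw [h, norm_zero] at ht
    norm_num at ht
  rw [eval_mul, eval_pow, eval_X, mul_eq_zero, or_iff_right ht0, Matrix.sub_apply, eval_sub,
    sub_eq_zero] at hij
  have h1 : eval t ((1 : Matrix (Fin 2) (Fin 2) ℂ[X]) i j) =
      (1 : Matrix (Fin 2) (Fin 2) ℂ) i j := by
    rw [Matrix.one_apply, Matrix.one_apply]
    split_ifs <;> simp
  simpa [φ, h1] using hij

/-- Since `v f(uv) = f(vu) v`, multiplying by `u` on the right gives `f(vu) vu = 0`. -/
theorem aeval_mul_swap_eq_zero {u v : R} {f : ℂ[X]} (h : aeval (u * v) f = 0) :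
    aeval (v * u) (X * f) = 0 := by
  have hswap (g : ℂ[X]) : v * aeval (u * v) g = aeval (v * u) g * v := by
    induction g using Polynomial.induction_on' with
    | add p q hp hq => simp [mul_add, add_mul, hp, hq]
    | monomial n z =>
      have hpow : v * (u * v) ^ n = (v * u) ^ n * v := by
        induction n with
        | zero => simp
        | succ n ih => rw [pow_succ, ← mul_assoc, ih, pow_succ]; simp only [mul_assoc]
      simp only [aeval_monomial, ← Algebra.smul_def, mul_smul_comm, smul_mul_assoc, hpow]
  rw [mul_comm, map_mul, aeval_X, ← mul_assoc, ← hswap, h, mul_zero, zero_mul]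

end SquareZero

/-! ### Trace and dimension on `ℓ²(G)`. -/

section GroupVonNeumann

open Polynomial ContinuousLinearMap
open scoped InnerProductSpace

/-- The unitary operator on `ℓ²(ι)` that permutes the coordinates. -/
noncomputable def permuteCoords {ι : Type*} (σ : Equiv.Perm ι) :
    lp (fun _ : ι => ℂ) 2 →L[ℂ] lp (fun _ : ι => ℂ) 2 :=
  LinearMap.mkContinuous
    { toFun := fun f => ⟨fun s => f (σ.symm s), by
        have hf := lp.memℓp f
        refine (memℓp_gen_iff (by norm_num)).mpr ?_
        rw [memℓp_gen_iff (by norm_num)] at hf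
        exact (σ.symm.summable_iff (f := fun i => ‖f i‖ ^ ENNReal.toReal 2)).mpr hf⟩
      map_add' := fun _ _ => rfl
      map_smul' := fun _ _ => rfl } 1 fun f => by
    rw [one_mul, lp.norm_eq_tsum_rpow (by norm_num), lp.norm_eq_tsum_rpow (by norm_num)]
    exact (congrArg (· ^ (1 / ENNReal.toReal 2))
      (σ.symm.tsum_eq fun i => ‖f i‖ ^ ENNReal.toReal 2)).le

section Permute

variable {ι : Type*}

@[simp]
theorem permuteCoords_apply (σ : Equiv.Perm ι) (f : lp (fun _ : ι => ℂ) 2) (s : ι) :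
    permuteCoords σ f s = f (σ.symm s) := rfl

theorem permuteCoords_mul (σ τ : Equiv.Perm ι) :
    permuteCoords (σ * τ) = permuteCoords σ * permuteCoords τ := rfl

theorem permuteCoords_single [DecidableEq ι] (σ : Equiv.Perm ι) (i : ι) (z : ℂ) :
    permuteCoords σ (lp.single 2 i z) = lp.single 2 (σ i) z := by
  ext s
  simp [lp.single_apply, Pi.single_apply, Equiv.symm_apply_eq]

theorem inner_permuteCoords (σ : Equiv.Perm ι) (f g : lp (fun _ : ι => ℂ) 2) :
    ⟪permuteCoords σ f, g⟫_ℂ = ⟪f, permuteCoords σ.symm g⟫_ℂ := by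
  rw [lp.inner_eq_tsum, lp.inner_eq_tsum, ← σ.tsum_eq]
  simp

end Permute

variable {G : Type*} [Group G]

/-- Left translation by `g` on `ℓ²(G)`, as a representation. -/
noncomputable def leftTranslation (G : Type*) [Group G] :
    G →* (lp (fun _ : G => ℂ) 2 →L[ℂ] lp (fun _ : G => ℂ) 2) where
  toFun g := permuteCoords (Equiv.mulLeft g)
  map_one' := by rw [Equiv.mulLeft_one]; rfl
  map_mul' g h := by rw [← permuteCoords_mul, Equiv.mulLeft_mul]

/-- Right translation by `g` on `ℓ²(G)`. -/
noncomputable def rightTranslation (g : G) :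
    lp (fun _ : G => ℂ) 2 →L[ℂ] lp (fun _ : G => ℂ) 2 :=
  permuteCoords (Equiv.mulRight g)

/-- The operators on `ℓ²(G)` that commute with right translations. -/
noncomputable def rightCommutant (G : Type*) [Group G] :
    Subalgebra ℂ (lp (fun _ : G => ℂ) 2 →L[ℂ] lp (fun _ : G => ℂ) 2) :=
  Subalgebra.centralizer ℂ (Set.range rightTranslation)

theorem mem_rightCommutant {A : lp (fun _ : G => ℂ) 2 →L[ℂ] lp (fun _ : G => ℂ) 2} :
    A ∈ rightCommutant G ↔ ∀ g x, A (rightTranslation g x) = rightTranslation g (A x) := by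
  simp only [rightCommutant, Subalgebra.mem_centralizer_iff, Set.forall_mem_range,
    ContinuousLinearMap.ext_iff, mul_apply_eq_comp]
  exact forall₂_congr fun _ _ => eq_comm

theorem leftTranslation_mem (g : G) : leftTranslation G g ∈ rightCommutant G := by
  refine mem_rightCommutant.mpr fun h x => ?_
  ext s
  simp [leftTranslation, rightTranslation, mul_assoc]

open Classical in
/-- The basis vector of `ℓ²(G)` at the identity. -/
noncomputable def deltaOne (G : Type*) [Group G] : lp (fun _ : G => ℂ) 2 := lp.single 2 1 1

/-- The canonical trace on operators of `ℓ²(G)`. -/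
noncomputable def ltwoTrace (A : lp (fun _ : G => ℂ) 2 →L[ℂ] lp (fun _ : G => ℂ) 2) : ℂ :=
  A (deltaOne G) 1

theorem inner_deltaOne (f : lp (fun _ : G => ℂ) 2) : ⟪deltaOne G, f⟫_ℂ = f 1 := by
  classical
  have h := lp.inner_single_left (𝕜 := ℂ) (1 : G) (1 : ℂ) f
  rw [RCLike.inner_apply, map_one, mul_one] at h
  rw [← h, deltaOne]

theorem norm_deltaOne : ‖deltaOne G‖ = 1 := by
  classical
  rw [deltaOne, lp.norm_single (by norm_num), norm_one]

section Trace

variable {A B : lp (fun _ : G => ℂ) 2 →L[ℂ] lp (fun _ : G => ℂ) 2}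

theorem ltwoTrace_add : ltwoTrace (A + B) = ltwoTrace A + ltwoTrace B := rfl

theorem ltwoTrace_sub : ltwoTrace (A - B) = ltwoTrace A - ltwoTrace B := rfl

theorem ltwoTrace_smul (z : ℂ) : ltwoTrace (z • A) = z * ltwoTrace A := rfl

theorem ltwoTrace_sum {κ : Type*} (s : Finset κ)
    (F : κ → lp (fun _ : G => ℂ) 2 →L[ℂ] lp (fun _ : G => ℂ) 2) :
    ltwoTrace (∑ i ∈ s, F i) = ∑ i ∈ s, ltwoTrace (F i) :=
  map_sum (AddMonoidHom.mk' ltwoTrace fun _ _ => ltwoTrace_add) F s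

theorem ltwoTrace_leftTranslation [DecidableEq G] (g : G) :
    ltwoTrace (leftTranslation G g) = if g = 1 then 1 else 0 := by
  simp [ltwoTrace, leftTranslation, deltaOne, lp.single_apply, Pi.single_apply]

/-- An operator commuting with right translations is determined by its value at `δ₁`, and the
adjoint sends `δ₁` to the conjugate of that value read at inverses. The sum is symmetric under `g ↦
g⁻¹`, which yields the trace property. -/
theorem ltwoTrace_mul_eq_tsum (hA : A ∈ rightCommutant G) :
    ltwoTrace (A * B) = ∑' g, A (deltaOne G) g⁻¹ * B (deltaOne G) g := by
  classical
  rw [ltwoTrace, ← inner_deltaOne, mul_apply_eq_comp, ← adjoint_inner_left,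
    lp.inner_eq_tsum]
  refine tsum_congr fun g => ?_
  have h1 : deltaOne G = lp.single 2 1 1 := by rw [deltaOne]
  have h2 : rightTranslation g (deltaOne G) = lp.single 2 g 1 := by
    rw [h1, rightTranslation, permuteCoords_single, Equiv.coe_mulRight]
    simp only [one_mul]
  have h3 : adjoint A (deltaOne G) g = starRingEnd ℂ (A (deltaOne G) g⁻¹) := by
    have h4 := lp.inner_single_left (𝕜 := ℂ) g (1 : ℂ) (adjoint A (deltaOne G))
    rw [adjoint_inner_right, ← h2, mem_rightCommutant.mp hA, ← inner_conj_symm,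
      inner_deltaOne] at h4
    simpa [rightTranslation] using h4.symm
  rw [h3, RCLike.inner_apply, RCLike.conj_conj, mul_comm]

theorem ltwoTrace_mul_comm (hA : A ∈ rightCommutant G) (hB : B ∈ rightCommutant G) :
    ltwoTrace (A * B) = ltwoTrace (B * A) := by
  rw [ltwoTrace_mul_eq_tsum hA, ltwoTrace_mul_eq_tsum hB, ← (Equiv.inv G).tsum_eq]
  exact tsum_congr fun g => by simp [mul_comm]

end Trace

section Projection

variable {V W : Submodule ℂ (lp (fun _ : G => ℂ) 2)}

theorem starProjection_mem_rightCommutant [V.HasOrthogonalProjection]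
    (hV : ∀ g, ∀ v ∈ V, rightTranslation g v ∈ V) : V.starProjection ∈ rightCommutant G := by
  refine mem_rightCommutant.mpr fun g x => ?_
  refine Submodule.eq_starProjection_of_mem_of_inner_eq_zero
    (hV g _ (V.starProjection_apply_mem x)) fun w hw => ?_
  rw [← map_sub, rightTranslation, inner_permuteCoords]
  refine Submodule.starProjection_inner_eq_zero x _ ?_
  simpa [rightTranslation] using hV g⁻¹ w hw

theorem ltwoTrace_starProjection [V.HasOrthogonalProjection] :
    ltwoTrace V.starProjection = (‖V.starProjection (deltaOne G)‖ ^ 2 : ℝ) := by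
  have h : V.starProjection (deltaOne G) = V.starProjection (V.starProjection (deltaOne G)) :=
    (Submodule.starProjection_eq_self_iff.mpr (V.starProjection_apply_mem _)).symm
  rw [ltwoTrace, ← inner_deltaOne, h, ← Submodule.inner_starProjection_left_eq_right,
    inner_self_eq_norm_sq_to_K, ← h]
  push_cast
  rfl

/-- On `W ⊖ V` the operator `A` is the scalar `z` modulo `V`. The error `Y = (A - z)(Q - P)` has `PY
= Y` and `YP = 0`, so its trace vanishes. -/
theorem ltwoTrace_mul_starProjection_sub [V.HasOrthogonalProjection] [W.HasOrthogonalProjection]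
    {A : lp (fun _ : G => ℂ) 2 →L[ℂ] lp (fun _ : G => ℂ) 2} (hA : A ∈ rightCommutant G)
    (hV : ∀ g, ∀ v ∈ V, rightTranslation g v ∈ V) (hW : ∀ g, ∀ v ∈ W, rightTranslation g v ∈ W)
    (hVW : V ≤ W) (z : ℂ) (hAW : ∀ w ∈ W, (A - algebraMap ℂ _ z) w ∈ V) :
    ltwoTrace (A * W.starProjection) - ltwoTrace (A * V.starProjection) =
      z * (ltwoTrace W.starProjection - ltwoTrace V.starProjection) := by
  have hPV := starProjection_mem_rightCommutant hV
  have hPW := starProjection_mem_rightCommutant hW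
  set P := V.starProjection with hP
  set Q := W.starProjection with hQ
  have hQP : Q * P = P := by
    ext1 x
    exact Submodule.starProjection_eq_self_iff.mpr (hVW (V.starProjection_apply_mem x))
  set Y := (A - algebraMap ℂ _ z) * (Q - P) with hY
  have hYmem : Y ∈ rightCommutant G :=
    mul_mem (sub_mem hA (Subalgebra.algebraMap_mem _ z)) (sub_mem hPW hPV)
  have hPY : P * Y = Y := by
    ext1 x
    refine Submodule.starProjection_eq_self_iff.mpr (hAW _ ?_)
    exact W.sub_mem (W.starProjection_apply_mem x) (hVW (V.starProjection_apply_mem x))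
  have hYP : Y * P = 0 := by
    rw [hY, mul_assoc, sub_mul Q, hQP, V.isIdempotentElem_starProjection.eq, sub_self, mul_zero]
  have htr : ltwoTrace Y = 0 := by
    rw [← hPY, ltwoTrace_mul_comm hPV hYmem, hYP]
    rfl
  have hexp : Y = A * Q - A * P - z • (Q - P) := by
    rw [hY, sub_mul, mul_sub, Algebra.smul_def]
  rw [hexp, ltwoTrace_sub, ltwoTrace_sub, ltwoTrace_smul, ltwoTrace_sub, sub_eq_zero] at htr
  exact htr

/-- Successive preimages of `V` under the factors `A - z` form a filtration ending at the whole
space. Each layer adds `z` times its dimension to the trace, and the dimensions add up to that of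
the complement of `V`. -/
theorem norm_ltwoTrace_sub_le {A : lp (fun _ : G => ℂ) 2 →L[ℂ] lp (fun _ : G => ℂ) 2}
    (hA : A ∈ rightCommutant G) {r : ℝ} (l : List ℂ) (hl : ∀ z ∈ l, ‖z‖ ≤ r)
    (V : Submodule ℂ (lp (fun _ : G => ℂ) 2)) [CompleteSpace V]
    (hV : ∀ g, ∀ v ∈ V, rightTranslation g v ∈ V) (hAV : ∀ v ∈ V, A v ∈ V)
    (hprod : ∀ x, (l.map fun z => A - algebraMap ℂ _ z).prod x ∈ V) :
    ‖ltwoTrace A - ltwoTrace (A * V.starProjection)‖ ≤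
      r * (1 - ‖V.starProjection (deltaOne G)‖ ^ 2) := by
  induction l generalizing V with
  | nil =>
    have hP : V.starProjection = 1 := by
      ext1 x
      exact Submodule.starProjection_eq_self_iff.mpr (hprod x)
    simp [hP, norm_deltaOne]
  | cons z l ih =>
    let C := A - algebraMap ℂ _ z
    have hC : C ∈ rightCommutant G := sub_mem hA (Subalgebra.algebraMap_mem _ z)
    have hCapp (x) : C x = A x - z • x := rfl
    let W : Submodule ℂ (lp (fun _ : G => ℂ) 2) := V.comap (C : _ →ₗ[ℂ] _)
    have hmem (x) : x ∈ W ↔ C x ∈ V := Iff.rfl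
    have hVc : IsClosed (V : Set (lp (fun _ : G => ℂ) 2)) :=
      (completeSpace_coe_iff_isComplete.mp ‹_›).isClosed
    have hWc : IsClosed (W : Set (lp (fun _ : G => ℂ) 2)) := hVc.preimage C.continuous
    have : CompleteSpace W := hWc.completeSpace_coe
    have hVW : V ≤ W := fun v hv => V.sub_mem (hAV v hv) (V.smul_mem z hv)
    have hW : ∀ g, ∀ w ∈ W, rightTranslation g w ∈ W := fun g w hw => by
      rw [hmem, mem_rightCommutant.mp hC]
      exact hV g _ hw
    have hAW : ∀ w ∈ W, A w ∈ W := fun w hw => by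
      have h : C (A w) = A (C w) := by simp [hCapp]
      rw [hmem, h]
      exact hAV _ hw
    have h1 := ih (fun y hy => hl y (List.mem_cons_of_mem _ hy)) W hW hAW fun x => by
      simpa using! hprod x
    have h2 := ltwoTrace_mul_starProjection_sub hA hV hW hVW z fun w hw => hw
    rw [ltwoTrace_starProjection, ltwoTrace_starProjection, ← Complex.ofReal_sub] at h2
    have hmono : ‖V.starProjection (deltaOne G)‖ ≤ ‖W.starProjection (deltaOne G)‖ := by
      rw [← Submodule.starProjection_comp_starProjection_of_le hVW,
        ContinuousLinearMap.comp_apply]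
      exact Submodule.norm_starProjection_apply_le V _
    have hsq : 0 ≤ ‖W.starProjection (deltaOne G)‖ ^ 2 - ‖V.starProjection (deltaOne G)‖ ^ 2 :=
      sub_nonneg.mpr (pow_le_pow_left₀ (norm_nonneg _) hmono 2)
    have h3 : ‖ltwoTrace (A * W.starProjection) - ltwoTrace (A * V.starProjection)‖ ≤
        r * (‖W.starProjection (deltaOne G)‖ ^ 2 - ‖V.starProjection (deltaOne G)‖ ^ 2) := by
      rw [h2, norm_mul, Complex.norm_real, Real.norm_of_nonneg hsq]
      exact mul_le_mul_of_nonneg_right (hl z List.mem_cons_self) hsq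
    calc _ ≤ _ := norm_sub_le_norm_sub_add_norm_sub _ (ltwoTrace (A * W.starProjection)) _
      _ ≤ _ := add_le_add h1 h3
      _ = _ := by ring

/-- An operator commuting with right translations and killing `V` has a spectral value, seen by all
polynomial identities, that is at least its trace divided by the dimension of the complement of
`V`. -/
theorem exists_root_of_le_norm_ltwoTrace
    {A : lp (fun _ : G => ℂ) 2 →L[ℂ] lp (fun _ : G => ℂ) 2} (hA : A ∈ rightCommutant G)
    (V : Submodule ℂ (lp (fun _ : G => ℂ) 2)) [CompleteSpace V]
    (hV : ∀ g, ∀ v ∈ V, rightTranslation g v ∈ V) (hAV : ∀ v ∈ V, A v = 0) {c : ℝ}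
    (hpos : 0 < 1 - ‖V.starProjection (deltaOne G)‖ ^ 2)
    (hc : c * (1 - ‖V.starProjection (deltaOne G)‖ ^ 2) ≤ ‖ltwoTrace A‖) :
    ∃ t : ℂ, c ≤ ‖t‖ ∧ ∀ f : ℂ[X], aeval A f = 0 → f.eval t = 0 := by
  by_cases hint : IsIntegral ℂ A
  · have hne : (minpoly ℂ A).roots.toFinset.Nonempty := by
      have : Nontrivial (lp (fun _ : G => ℂ) 2) :=
        ⟨deltaOne G, 0, fun h => by simpa [h] using norm_deltaOne (G := G)⟩
      obtain ⟨z, hz⟩ := IsAlgClosed.exists_root (minpoly ℂ A) (minpoly.degree_pos hint).ne'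
      exact ⟨z, Multiset.mem_toFinset.mpr ((mem_roots (minpoly.ne_zero hint)).mpr hz)⟩
    -- A root of largest modulus bounds all the layers at once.
    obtain ⟨t, ht, hmax⟩ := Finset.exists_max_image _ (fun z : ℂ => ‖z‖) hne
    rw [Multiset.mem_toFinset] at ht
    refine ⟨t, ?_, fun f hf => ?_⟩
    · have hsplit := (IsAlgClosed.splits (minpoly ℂ A)).eq_prod_roots_of_monic (minpoly.monic hint)
      have hprod : ((minpoly ℂ A).roots.toList.map fun z => A - algebraMap ℂ _ z).prod = 0 := by
        have h := minpoly.aeval ℂ A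
        rw [hsplit, ← Multiset.coe_toList (minpoly ℂ A).roots, Multiset.map_coe,
          Multiset.prod_coe, map_list_prod, List.map_map] at h
        rw [← h]
        congr 2
        ext1 z
        simp
      have h := norm_ltwoTrace_sub_le hA (r := ‖t‖) (minpoly ℂ A).roots.toList
        (fun z hz => hmax z (by simpa using hz)) V hV
        (fun v hv => by rw [hAV v hv]; exact V.zero_mem) (fun x => by rw [hprod]; exact V.zero_mem)
      have hAP : A * V.starProjection = 0 := by
        ext1 x
        exact hAV _ (V.starProjection_apply_mem x)
      rw [hAP, show ltwoTrace (0 : lp (fun _ : G => ℂ) 2 →L[ℂ] lp (fun _ : G => ℂ) 2) = 0 from rfl,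
        sub_zero] at h
      exact le_of_mul_le_mul_right (hc.trans h) hpos
    · obtain ⟨q, rfl⟩ := minpoly.dvd ℂ A hf
      rw [eval_mul, (isRoot_of_mem_roots ht).eq_zero, zero_mul]
  -- Without algebraicity only `f = 0` kills `A`, so any `t` of modulus at least `c` will do.
  · refine ⟨(max c 0 : ℝ), ?_, fun f hf => ?_⟩
    · rw [Complex.norm_real]
      exact (le_max_left c 0).trans (le_abs_self _)
    · by_contra hne
      refine hint (isAlgebraic_iff_isIntegral.mp ⟨f, fun h => hne ?_, hf⟩)
      rw [h, eval_zero]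

end Projection

end GroupVonNeumann

/-! ### The group ring acting on `ℓ²(G)`. -/

namespace IntegralGroupRing

open Polynomial ContinuousLinearMap
open scoped InnerProductSpace

variable {G : Type*} [Group G]

/-- The action of the integral group ring on `ℓ²(G)` by left translations. -/
noncomputable def leftRegular (G : Type*) [Group G] :
    MonoidAlgebra ℤ G →+* (lp (fun _ : G => ℂ) 2 →L[ℂ] lp (fun _ : G => ℂ) 2) :=
  (MonoidAlgebra.lift ℤ (lp (fun _ : G => ℂ) 2 →L[ℂ] lp (fun _ : G => ℂ) 2) G
    (leftTranslation G)).toRingHom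

theorem leftRegular_el (g : G) : leftRegular G (el g) = leftTranslation G g :=
  MonoidAlgebra.lift_of _ _

theorem leftRegular_mem (a : MonoidAlgebra ℤ G) : leftRegular G a ∈ rightCommutant G := by
  induction a using MonoidAlgebra.induction_on with
  | of g => exact leftRegular_el g ▸ leftTranslation_mem g
  | add x y hx hy => exact map_add (leftRegular G) x y ▸ add_mem hx hy
  | smul n x hx => exact map_zsmul (leftRegular G) n x ▸ zsmul_mem hx n

theorem el_mul_el (g h : G) : el g * el h = el (g * h) := (map_mul _ _ _).symm

theorem el_one : el (1 : G) = 1 := map_one _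

section SubgroupSum

variable (K : Subgroup G) [Finite K]

theorem card_toFinset : (Set.toFinite (K : Set G)).toFinset.card = Nat.card K :=
  (Nat.card_eq_card_finite_toFinset (Set.toFinite (K : Set G))).symm

theorem subgroupSum_sq : subgroupSum K * subgroupSum K = Nat.card K • subgroupSum K := by
  nth_rw 2 [subgroupSum]
  rw [Finset.mul_sum, Finset.sum_congr rfl fun g hg => subgroupSum_mul_el K (by simpa using hg),
    Finset.sum_const, card_toFinset]

theorem inner_leftRegular_subgroupSum (f w : lp (fun _ : G => ℂ) 2) :
    ⟪leftRegular G (subgroupSum K) f, w⟫_ℂ = ⟪f, leftRegular G (subgroupSum K) w⟫_ℂ := by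
  simp only [subgroupSum, map_sum, leftRegular_el, sum_apply, sum_inner,
    inner_sum]
  refine Finset.sum_bij' (fun g _ => g⁻¹) (fun g _ => g⁻¹) ?_ ?_ ?_ ?_ ?_
  · intro g hg; simpa using hg
  · intro g hg; simpa using hg
  · intro g _; simp
  · intro g _; simp
  · intro g _
    exact (inner_permuteCoords (Equiv.mulLeft g) f w).trans (by rw [Equiv.mulLeft_symm]; rfl)

open Classical in
theorem ltwoTrace_el_mul_subgroupSum (g : G) :
    ltwoTrace (leftRegular G (el g * subgroupSum K)) = if g ∈ K then 1 else 0 := by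
  rw [subgroupSum, Finset.mul_sum, map_sum, ltwoTrace_sum]
  simp only [el_mul_el, leftRegular_el, ltwoTrace_leftTranslation, mul_eq_one_iff_eq_inv']
  simp [Finset.sum_ite_eq']

/-- Let `ab = uv` with `vu` a left multiple of the sum of `K`. If the trace of `vu` is large enough,
then `1 + a` and `1 + b` freely generate a free group. -/
theorem isFreePair_of_le_ltwoTrace {a b u v w : MonoidAlgebra ℤ G} (ha : a * a = 0) (hb : b * b = 0)
    (huv : a * b = u * v) (hvu : v * u = w * subgroupSum K)
    (htr : 4 ≤ Nat.card K * ‖ltwoTrace (leftRegular G (w * subgroupSum K))‖) :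
    IsFreePair (unitOneAdd a ha) (unitOneAdd b hb) := by
  set S := leftRegular G (subgroupSum K) with hS
  set n : ℝ := (Nat.card K : ℝ) with hn
  have hnpos : 0 < n := Nat.cast_pos.mpr Nat.card_pos
  have hn0 : (n : ℂ) ≠ 0 := by exact_mod_cast hnpos.ne'
  let V : Submodule ℂ (lp (fun _ : G => ℂ) 2) := LinearMap.ker S.toLinearMap
  have hmem (x) : x ∈ V ↔ S x = 0 := Iff.rfl
  have hVc : IsClosed (V : Set (lp (fun _ : G => ℂ) 2)) := S.isClosed_ker
  have : CompleteSpace V := hVc.completeSpace_coe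
  have hSS (x) : S (S x) = (n : ℂ) • S x := by
    rw [← mul_apply_eq_comp, hS, ← map_mul, subgroupSum_sq, map_nsmul]
    simp [hn, Nat.cast_smul_eq_nsmul]
  -- `S / n` is a self-adjoint idempotent, so the projection onto its kernel is `1 - S / n`.
  have hproj : V.starProjection (deltaOne G) = deltaOne G - (n : ℂ)⁻¹ • S (deltaOne G) := by
    refine Submodule.eq_starProjection_of_mem_of_inner_eq_zero ?_ fun x hx => ?_
    · rw [hmem, map_sub, map_smul, hSS, smul_smul, inv_mul_cancel₀ hn0, one_smul, sub_self]
    · rw [sub_sub_cancel, inner_smul_left, hS, inner_leftRegular_subgroupSum,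
        show leftRegular G (subgroupSum K) x = 0 from hx, inner_zero_right, mul_zero]
  have htrS : ltwoTrace S = 1 := by
    have h := ltwoTrace_el_mul_subgroupSum K 1
    rwa [el_one, one_mul, if_pos K.one_mem] at h
  have hdim : 1 - ‖V.starProjection (deltaOne G)‖ ^ 2 = n⁻¹ := by
    have h1 : ltwoTrace V.starProjection = 1 - (n : ℂ)⁻¹ * ltwoTrace S := by
      rw [ltwoTrace, hproj]
      have h2 := inner_deltaOne (deltaOne G)
      rw [inner_self_eq_norm_sq_to_K, norm_deltaOne, RCLike.ofReal_one, one_pow] at h2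
      rw [h2]
      rfl
    rw [htrS, ltwoTrace_starProjection, mul_one] at h1
    have h3 : ‖V.starProjection (deltaOne G)‖ ^ 2 = 1 - n⁻¹ := by exact_mod_cast h1
    rw [h3, sub_sub_cancel]
  obtain ⟨t, ht, hroot⟩ := exists_root_of_le_norm_ltwoTrace
    (leftRegular_mem (w * subgroupSum K)) V
    (fun g x hx => by
      rw [hmem, mem_rightCommutant.mp (leftRegular_mem _), (hmem x).mp hx, map_zero])
    (fun x hx => by rw [map_mul, mul_apply_eq_comp, ← hS, (hmem x).mp hx, map_zero])
    (c := 4) (by rw [hdim]; positivity)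
    (by rw [hdim, mul_inv_le_iff₀ hnpos, mul_comm]; exact htr)
  have ht0 : t ≠ 0 := by
    rintro rfl
    norm_num at ht
  have haS : leftRegular G a * leftRegular G a = 0 := by rw [← map_mul, ha, map_zero]
  have hbS : leftRegular G b * leftRegular G b = 0 := by rw [← map_mul, hb, map_zero]
  refine IsFreePair.of_map_unitOneAdd (leftRegular G) ha hb haS hbS ?_
  refine isFreePair_unitOneAdd_of_root haS hbS ht fun f hf => ?_
  rw [← map_mul, huv, map_mul] at hf
  have hf' := aeval_mul_swap_eq_zero hf
  rw [← map_mul, hvu] at hf'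
  have h := hroot _ hf'
  rwa [eval_mul, eval_X, mul_eq_zero, or_iff_right ht0] at h

/-- The trace of `g K̄` is `1` or `0` according to whether `g ∈ K`. Each `s` contributes `1`, the
two negative terms contribute nothing, and the `d s` term can only help. -/
theorem isFreePair_of_sum {H : Subgroup G} [Finite H] (hHK : H ≤ K) (hH : H ≠ ⊥) (p : G)
    (c : G → G) (hp : p ∉ K) (hq : ∀ s ∈ H, c s ∉ K) (d : G → G)
    {a b u v : MonoidAlgebra ℤ G} (ha : a * a = 0) (hb : b * b = 0)
    (huv : a * b = u * v)
    (hvu : v * u = (∑ s ∈ (Set.toFinite (H : Set G)).toFinset,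
      (el s - el (p * s) - el (c s) + el (d s))) * subgroupSum K) :
    IsFreePair (unitOneAdd a ha) (unitOneAdd b hb) := by
  classical
  refine isFreePair_of_le_ltwoTrace K ha hb huv hvu ?_
  have hH2 : (2 : ℝ) ≤ Nat.card H := by
    exact_mod_cast Nat.succ_le_of_lt (H.one_lt_card_iff_ne_bot.mpr hH)
  have hK2 : (Nat.card H : ℝ) ≤ Nat.card K := by
    exact_mod_cast Subgroup.card_le_of_le hHK
  have hre : (Nat.card H : ℝ) ≤ (ltwoTrace (leftRegular G ((∑ s ∈ (Set.toFinite (H : Set G)).toFinset,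
      (el s - el (p * s) - el (c s) + el (d s))) * subgroupSum K))).re := by
    rw [Finset.sum_mul, map_sum, ltwoTrace_sum, Complex.re_sum, ← card_toFinset,
      Finset.card_eq_sum_ones, Nat.cast_sum]
    refine Finset.sum_le_sum fun s hs => ?_
    have hs : s ∈ H := by simpa using hs
    have hps : p * s ∉ K := fun h => hp ((K.mul_mem_cancel_right (hHK hs)).mp h)
    rw [add_mul, sub_mul, sub_mul, map_add, map_sub, map_sub, ltwoTrace_add, ltwoTrace_sub,
      ltwoTrace_sub]
    simp only [ltwoTrace_el_mul_subgroupSum, if_pos (hHK hs), if_neg hps, if_neg (hq s hs)]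
    split_ifs <;> simp
  have hnorm := hre.trans (Complex.re_le_norm _)
  nlinarith

end SubgroupSum

theorem el_mul_subgroupSum_conjSubgroup (x : G) (K : Subgroup G) [Finite K] :
    el x⁻¹ * subgroupSum (conjSubgroup x K) = subgroupSum K * el x⁻¹ := by
  rw [subgroupSum, subgroupSum, Finset.mul_sum, Finset.sum_mul]
  refine Finset.sum_bij' (fun g _ => x⁻¹ * g * x) (fun g _ => x * g * x⁻¹) ?_ ?_ ?_ ?_ ?_
  · intro g hg
    rw [Set.Finite.mem_toFinset] at hg ⊢
    obtain ⟨k, hk, rfl⟩ := hg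
    simpa [mul_assoc] using hk
  · intro g hg
    rw [Set.Finite.mem_toFinset] at hg ⊢
    exact conj_mem_conjSubgroup x hg
  · intro g _; simp [mul_assoc]
  · intro g _; simp [mul_assoc]
  · intro g _; simp [el_mul_el, mul_assoc]

end IntegralGroupRing

/-! ### The two factorizations `ab = uv`. -/

theorem mainTheorem3 {G : Type*} [Group G] (H K : Subgroup G) [Finite H] [Finite K]
    (hHK : H ≤ K) (x h k : G) (hh : h ∈ H) (hk : k ∈ K) (hxh : x⁻¹ * h * x ∉ K) :
    (x⁻¹ * k * x ∉ K →
      IsFreePair (IntegralGroupRing.beta x h H hh) (IntegralGroupRing.gamma x⁻¹ k K hk)) ∧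
    (x * k * x⁻¹ ∉ K →
      IsFreePair (IntegralGroupRing.beta x h H hh)
        (IntegralGroupRing.beta x⁻¹ (x * k * x⁻¹) (IntegralGroupRing.conjSubgroup x K)
          (IntegralGroupRing.conj_mem_conjSubgroup x hk))) := by
  open IntegralGroupRing in
  have hH : H ≠ ⊥ := by
    rintro rfl
    rw [Subgroup.mem_bot.mp hh] at hxh
    exact hxh (by simp)
  constructor
  · intro hxk
    -- Cutting `ab` just after `K̄` makes `K̄` the last factor of `vu`, with `w = x⁻¹(1 - k)(1 - h)x
    -- H̄`.
    refine isFreePair_of_sum K hHK hH (x⁻¹ * h * x) (fun s => x⁻¹ * k * x * s) hxh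
      (fun s hs hmem => hxk ((K.mul_mem_cancel_right (hHK hs)).mp hmem))
      (fun s => x⁻¹ * k * h * x * s) (beta_sq x h H hh) (gamma_sq x⁻¹ k K hk)
      (u := (1 - el h) * el x * subgroupSum H * subgroupSum K) (v := el x⁻¹ * (1 - el k))
      (by simp only [mul_assoc]) ?_
    rw [← mul_assoc]
    congr 1
    rw [← mul_assoc, subgroupSum, Finset.mul_sum]
    refine Finset.sum_congr rfl fun s _ => ?_
    simp only [mul_sub, sub_mul, mul_one, one_mul, el_mul_el, ← mul_assoc, inv_mul_cancel]
    abel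
  · intro hxk
    -- Moving `x⁻¹` across the conjugate's sum turns it into `K̄ x⁻¹`, so the cut after `K̄` leaves
    -- `v = x⁻¹`.
    refine isFreePair_of_sum K hHK hH (x⁻¹ * h * x) (fun s => s * (x * k * x⁻¹)) hxh
      (fun s hs hmem => hxk ((K.mul_mem_cancel_left (hHK hs)).mp hmem))
      (fun s => x⁻¹ * h * x * s * (x * k * x⁻¹)) (beta_sq x h H hh)
      (beta_sq x⁻¹ _ _ (conj_mem_conjSubgroup x hk))
      (u := (1 - el h) * el x * subgroupSum H * (1 - el (x * k * x⁻¹)) * subgroupSum K)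
      (v := el x⁻¹) ?_ ?_
    · rw [mul_assoc (1 - el (x * k * x⁻¹)), el_mul_subgroupSum_conjSubgroup]
      simp only [mul_assoc]
    · rw [← mul_assoc]
      congr 1
      rw [subgroupSum, Finset.mul_sum, Finset.sum_mul, Finset.mul_sum]
      refine Finset.sum_congr rfl fun s _ => ?_
      simp only [mul_sub, sub_mul, mul_one, one_mul, el_mul_el, ← mul_assoc, inv_mul_cancel]
      abel
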